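/- Let $K$ be a number field with ring of integers $\mathcal O_K$, and let $\widehat K=K\otimes_{\mathbb Q}\mathbb R$. Ideals below are nonzero integral ideals of $\mathcal O_K$, and $N$ denotes the absolute norm. An $\mathcal O_K$-lattice is a finitely generated $\mathcal O_K$-submodule $L\subset\widehat K^2$ with $\dim_K(KL)=2$ and $\widehat K L=\widehat K^2$. If $L\subseteq M$ are lattices, then $M/L\cong\mathcal O_K/\mathfrak a_1\oplus\mathcal O_K/\mathfrak a_2$ for unique ideals $\mathfrak a_1\mid\mathfrak a_2$, and we write $[M:L]=\mathfrak a_1\mathfrak a_2$. For an ideal $\mathfrak n$ let $\mathcal M_0(\mathfrak n)$ be the set of pairs $(L,L')$ of lattices with $L\subseteq L'$ and $L'/L\cong\mathcal O_K/\mathfrak n$ as $\mathcal O_K$-modules, and let $\mathbb Q\mathcal M_0(\mathfrak n)$ be the $\mathbb Q$-vector space with basis $\mathcal M_0(\mathfrak n)$. For an ideal $\mathfrak a$, the Hecke operator $T_{\mathfrak a}^{\mathfrak n}$ is the $\mathbb Q$-linear endomorphism of $\mathbb Q\mathcal M_0(\mathfrak n)$ with $$T_{\mathfrak a}^{\mathfrak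 n}(L,L')=N(\mathfrak a)^{-1}\sum_{M}(M,\,M+L'),$$ where the (finite) sum is over all lattices $M\supseteq L$ with $[M:L]=\mathfrak a$ and $(M,M+L')\in\mathcal M_0(\mathfrak n)$. For ideals $\mathfrak m\mid\mathfrak n$ and $\mathfrak d\mid\mathfrak m^{-1}\mathfrak n$, the level-changing operator $A_{\mathfrak d}:\mathbb Q\mathcal M_0(\mathfrak n)\to\mathbb Q\mathcal M_0(\mathfrak m)$ is the $\mathbb Q$-linear map with $$A_{\mathfrak d}(L,L')=N(\mathfrak d)\,\bigl(L\cap\mathfrak dL',\ (L\cap\mathfrak dL')+\mathfrak m^{-1}\mathfrak nL'\bigr).$$ Let $\mathfrak m\mid\mathfrak n$ and $\mathfrak d\mid\mathfrak m^{-1}\mathfrak n$. 1. For every nonzero prime ideal $\mathfrak p\nmid\mathfrak n$, one has $A_{\mathfrak d}T_{\mathfrak p}^{\mathfrak n}=T_{\mathfrak p}^{\mathfrak m}A_{\mathfrak d}$ as maps $\mathbb Q\mathcal M_0(\mathfrak n)\to\mathbb Q\mathcal M_0(\mathfrak m)$. 2. For every integral ideal $\mathfrak a$ coprime to $\mathfrak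 n$, one has $A_{\mathfrak d}T_{\mathfrak a}^{\mathfrak n}=T_{\mathfrak a}^{\mathfrak m}A_{\mathfrak d}$ as maps $\mathbb Q\mathcal M_0(\mathfrak n)\to\mathbb Q\mathcal M_0(\mathfrak m)$. -/

import Mathlib

open scoped NumberField TensorProduct

noncomputable section

namespace ModularLattice

/-- The space of row vectors `K̂ ⊕ K̂`, where `K̂ = K ⊗_ℚ ℝ`; the field `K` (and its ring of
integers) acts through the diagonal embedding `K → K̂`. -/
abbrev RowSpace (K : Type*) [Field K] [NumberField K] : Type _ := Fin 2 → K ⊗[ℚ] ℝ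

section Lattices

variable {K : Type*} [Field K] [NumberField K]

/-- An `𝓞 K`-lattice in `K̂²`: a finitely generated `𝓞 K`-submodule `L` with `dim_K (K L) = 2`
and `K̂ L = K̂²`. -/
structure IsLattice (L : Submodule (𝓞 K) (RowSpace K)) : Prop where
  fg : L.FG
  finrank_span : Module.finrank K (Submodule.span K (L : Set (RowSpace K))) = 2
  span_eq_top : Submodule.span (K ⊗[ℚ] ℝ) (L : Set (RowSpace K)) = ⊤

/-- The quotient module `L' / L`, meant for `L ≤ L'`. -/
abbrev relQuot (L' L : Submodule (𝓞 K) (RowSpace K)) : Type _ := L' ⧸ L.submoduleOf L'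

/-- `[M : L] = 𝔞`: one has `L ⊆ M`, and `𝔞` is the product `𝔞₁ 𝔞₂` of the elementary divisors
`𝔞₁ ∣ 𝔞₂` of `M / L`. -/
def HasIndex (M L : Submodule (𝓞 K) (RowSpace K)) (a : Ideal (𝓞 K)) : Prop :=
  L ≤ M ∧ ∃ a₁ a₂ : Ideal (𝓞 K), a₁ ∣ a₂ ∧ a₁ * a₂ = a ∧
    Nonempty (relQuot M L ≃ₗ[𝓞 K] (𝓞 K ⧸ a₁) × (𝓞 K ⧸ a₂))

lemma smul_inj {r : 𝓞 K} (hr : r ≠ 0) {v w : RowSpace K} (h : r • v = r • w) : v = w := by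
  have hr' : (r : K) ≠ 0 := by simpa using hr
  have key : ∀ x : RowSpace K, ((r : K)⁻¹) • (r • x) = x := fun x => by
    have : r • x = (r : K) • x := (algebraMap_smul K r x).symm
    rw [this, smul_smul, inv_mul_cancel₀ hr', one_smul]
  rw [← key v, h, key w]

lemma quot_smul_eq_zero {R : Type*} [CommRing R] {I : Ideal R} {r : R} (hr : r ∈ I)
    (y : R ⧸ I) : r • y = 0 := by
  obtain ⟨y, rfl⟩ := Ideal.Quotient.mk_surjective y
  exact Ideal.Quotient.eq_zero_iff_mem.2 (Ideal.mul_mem_right y I hr)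

lemma exists_smul_eq_of_mem {R M : Type*} [CommRing R] [AddCommGroup M] [Module R M] {r : R}
    {x : M} (hx : x ∈ Ideal.span {r} • (⊤ : Submodule R M)) : ∃ z : M, r • z = x := by
  rw [Submodule.ideal_span_singleton_smul] at hx
  obtain ⟨z, -, hz⟩ := (Submodule.mem_smul_pointwise_iff_exists _ _ _).1 hx
  exact ⟨z, hz⟩

/-- A submodule `L` of a lattice `N` that is commensurable with it is a lattice. -/
lemma IsLattice.of_le {L N : Submodule (𝓞 K) (RowSpace K)} (hN : IsLattice N)
    {L₀ : Submodule (𝓞 K) (RowSpace K)} (hle : L ≤ N) {r : 𝓞 K} (hr : r ≠ 0)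
    (hmul : ∀ x ∈ L₀, r • x ∈ L) (hNL : ∀ x ∈ N, ∃ s : 𝓞 K, s ≠ 0 ∧ s • x ∈ L₀) :
    IsLattice L := by
  have hinv : ∀ (s : 𝓞 K), s ≠ 0 → ∀ x : RowSpace K, ((s : K)⁻¹) • (s • x) = x := by
    intro s hs x
    have hs' : (s : K) ≠ 0 := by simpa using hs
    have : s • x = (s : K) • x := (algebraMap_smul K s x).symm
    rw [this, smul_smul, inv_mul_cancel₀ hs', one_smul]
  have hmem : ∀ x ∈ N, x ∈ Submodule.span K (L : Set (RowSpace K)) := by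
    intro x hx
    obtain ⟨s, hs, hsx⟩ := hNL x hx
    have h1 := hmul _ hsx
    rw [← hinv s hs x, ← hinv r hr (s • x)]
    exact Submodule.smul_mem _ _ (Submodule.smul_mem _ _ (Submodule.subset_span h1))
  have hspan : Submodule.span K (L : Set (RowSpace K)) = Submodule.span K (N : Set (RowSpace K)) :=
    le_antisymm (Submodule.span_mono hle) (Submodule.span_le.2 hmem)
  refine ⟨?_, ?_, ?_⟩
  · have : Module.Finite (𝓞 K) N := Module.Finite.iff_fg.2 hN.fg
    have : IsNoetherian (𝓞 K) N := isNoetherian_of_isNoetherianRing_of_finite _ _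
    have := (isNoetherian_submodule.1 this) L hle
    exact this
  · rw [hspan]; exact hN.finrank_span
  · rw [eq_top_iff, ← hN.span_eq_top]
    refine Submodule.span_le.2 fun x hx => ?_
    have h := hmem x hx
    have hle' : Submodule.span K (L : Set (RowSpace K)) ≤
        (Submodule.span (K ⊗[ℚ] ℝ) (L : Set (RowSpace K))).restrictScalars K :=
      Submodule.span_le.2 fun y hy => Submodule.subset_span hy
    exact hle' h

/-- `L' / L ≅ 𝓞 K / 𝔫` means that `L'` is generated over `L` by one element whose annihilator
modulo `L` is `𝔫`. -/
lemma nonempty_relQuot_equiv_iff {L L' : Submodule (𝓞 K) (RowSpace K)} (hle : L ≤ L')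
    (n : Ideal (𝓞 K)) :
    Nonempty (relQuot L' L ≃ₗ[𝓞 K] (𝓞 K ⧸ n)) ↔
      ∃ β : RowSpace K, L' = L ⊔ Submodule.span (𝓞 K) {β} ∧ ∀ r : 𝓞 K, r • β ∈ L ↔ r ∈ n := by
  constructor
  · rintro ⟨e⟩
    obtain ⟨β, hβ⟩ := Submodule.Quotient.mk_surjective _ (e.symm (Submodule.Quotient.mk 1))
    have he : ∀ r : 𝓞 K, e (Submodule.Quotient.mk (r • β)) = Submodule.Quotient.mk r := by
      intro r
      rw [Submodule.Quotient.mk_smul, hβ, map_smul, LinearEquiv.apply_symm_apply,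
        ← Submodule.Quotient.mk_smul, smul_eq_mul, mul_one]
    refine ⟨β, le_antisymm ?_ ?_, ?_⟩
    · intro x hx
      obtain ⟨r, hr⟩ := Submodule.Quotient.mk_surjective _ (e (Submodule.Quotient.mk ⟨x, hx⟩))
      rw [← he r] at hr
      have h := (Submodule.Quotient.eq _).1 (e.injective hr)
      have h' : r • (β : RowSpace K) - x ∈ L := h
      have : x = -(r • (β : RowSpace K) - x) + r • (β : RowSpace K) := by abel
      rw [this]
      exact Submodule.add_mem_sup (neg_mem h')
        (Submodule.smul_mem _ _ (Submodule.mem_span_singleton_self _))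
    · exact sup_le hle (by simp [Submodule.span_le])
    · intro r
      have h1 : r • (β : RowSpace K) ∈ L ↔
          (Submodule.Quotient.mk (r • β) : relQuot L' L) = 0 := by
        rw [Submodule.Quotient.mk_eq_zero]; rfl
      rw [h1, ← e.map_eq_zero_iff, he r, Submodule.Quotient.mk_eq_zero]
  · rintro ⟨β, hL', hβ⟩
    have hβ' : β ∈ L' := hL' ▸ Submodule.mem_sup_right (Submodule.mem_span_singleton_self _)
    let f : 𝓞 K →ₗ[𝓞 K] relQuot L' L :=
      (Submodule.mkQ _).comp (LinearMap.toSpanSingleton (𝓞 K) L' ⟨β, hβ'⟩)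
    have hf : ∀ r, f r = Submodule.Quotient.mk (r • ⟨β, hβ'⟩) := fun r => rfl
    have hker : LinearMap.ker f = n := by
      ext r
      rw [LinearMap.mem_ker, hf, Submodule.Quotient.mk_eq_zero, ← hβ r]
      rfl
    have hsurj : Function.Surjective f := by
      intro q
      obtain ⟨⟨x, hx⟩, rfl⟩ := Submodule.Quotient.mk_surjective _ q
      have hx' := hx
      rw [hL'] at hx'
      obtain ⟨y, hy, z, hz, hyz⟩ := Submodule.mem_sup.1 hx'
      obtain ⟨r, rfl⟩ := Submodule.mem_span_singleton.1 hz
      refine ⟨r, ?_⟩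
      rw [hf]
      refine (Submodule.Quotient.eq _).2 ?_
      change r • β - x ∈ L
      rw [← hyz]
      simpa using hy
    exact ⟨((Submodule.quotEquivOfEq _ _ hker.symm).trans
      (f.quotKerEquivOfSurjective hsurj)).symm⟩

end Lattices

section ModularPoints

variable (K : Type*) [Field K] [NumberField K]

/-- The set `𝓜₀(𝔫)` of modular points for `Γ₀(𝔫)`: pairs `(L, L')` of lattices with `L ⊆ L'` and
`L' / L ≅ 𝓞 K / 𝔫`. -/
@[ext]
structure ModularPoint (n : Ideal (𝓞 K)) where
  L : Submodule (𝓞 K) (RowSpace K)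
  L' : Submodule (𝓞 K) (RowSpace K)
  isLattice : IsLattice L
  isLattice' : IsLattice L'
  le : L ≤ L'
  quot : Nonempty (relQuot L' L ≃ₗ[𝓞 K] (𝓞 K ⧸ n))

/-- The vector space `ℚ𝓜₀(𝔫)` of formal finite linear combinations of modular points. -/
abbrev ModularSpace (n : Ideal (𝓞 K)) : Type _ := ModularPoint K n →₀ ℚ

variable {K}

/-- The modular points `(M, M')` with `M ⊇ L`, `[M : L] = 𝔞` and `M' = M + L'`, that is, the terms
of the Hecke operator `T_𝔞` at the point `P = (L, L')`. -/
def heckeSet {n : Ideal (𝓞 K)} (a : Ideal (𝓞 K)) (P : ModularPoint K n) :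
    Set (ModularPoint K n) :=
  {Q | HasIndex Q.L P.L a ∧ Q.L' = Q.L ⊔ P.L'}

lemma heckeSet_finite {n a : Ideal (𝓞 K)} (ha : a ≠ ⊥) (P : ModularPoint K n) :
    (heckeSet a P).Finite := by
  obtain ⟨α, hαa, hα⟩ := Submodule.exists_mem_ne_zero_of_ne_bot ha
  -- the quotient of the lattice by its multiple by `α` is finite
  have hfin : Finite (P.L ⧸ (Ideal.span {α} • (⊤ : Submodule (𝓞 K) P.L))) := by
    have : Module.Finite (𝓞 K) P.L := Module.Finite.iff_fg.2 P.isLattice.fg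
    have : Finite (𝓞 K ⧸ Ideal.span {α}) :=
      (Ideal.span {α}).finiteQuotientOfFreeOfNeBot (by simpa using hα)
    exact Module.finite_of_finite (𝓞 K ⧸ Ideal.span {α})
  have hmul : ∀ Q ∈ heckeSet a P, ∀ x ∈ Q.L, α • x ∈ P.L := by
    rintro Q ⟨⟨hle, a₁, a₂, h12, h, ⟨e⟩⟩, -⟩ x hx
    have h2 : α ∈ a₂ := by rw [← h] at hαa; exact Ideal.mul_le_right hαa
    have h1 : α ∈ a₁ := by rw [← h] at hαa; exact Ideal.mul_le_left hαa
    have h0 : (Submodule.Quotient.mk (α • ⟨x, hx⟩) : relQuot Q.L P.L) = 0 := by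
      apply e.injective
      rw [Submodule.Quotient.mk_smul, map_smul, map_zero]
      generalize e (Submodule.Quotient.mk ⟨x, hx⟩) = y
      exact Prod.ext (quot_smul_eq_zero h1 y.1) (quot_smul_eq_zero h2 y.2)
    exact (Submodule.Quotient.mk_eq_zero (P.L.submoduleOf Q.L)).1 h0
  let φ : ModularPoint K n → Set (P.L ⧸ (Ideal.span {α} • (⊤ : Submodule (𝓞 K) P.L))) :=
    fun Q => {q | ∃ (x : RowSpace K) (_ : x ∈ Q.L) (hx : α • x ∈ P.L),
      Submodule.Quotient.mk ⟨α • x, hx⟩ = q}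
  have hsub : ∀ Q ∈ heckeSet a P, ∀ R ∈ heckeSet a P, φ Q = φ R → Q.L ≤ R.L := by
    intro Q hQ R hR h x hx
    have : (Submodule.Quotient.mk ⟨α • x, hmul Q hQ x hx⟩ : P.L ⧸ _) ∈ φ R :=
      h ▸ ⟨x, hx, hmul Q hQ x hx, rfl⟩
    obtain ⟨y, hy, hy', hyx⟩ := this
    have hd := (Submodule.Quotient.eq _).1 hyx
    obtain ⟨z, hz⟩ := exists_smul_eq_of_mem hd
    have hz' : α • (z : RowSpace K) = α • y - α • x := congrArg Subtype.val hz
    rw [← smul_sub] at hz'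
    have := smul_inj hα hz'
    have hx' : x = y - z := by rw [this]; abel
    rw [hx']
    exact sub_mem hy (hR.1.1 z.2)
  refine Set.Finite.of_finite_image (f := φ) (Set.toFinite _) ?_
  intro Q hQ R hR h
  have hL : Q.L = R.L := le_antisymm (hsub Q hQ R hR h) (hsub R hR Q hQ h.symm)
  exact ModularPoint.ext hL (by rw [hQ.2, hR.2, hL])

/-- The Hecke operator `T_𝔞` at level `𝔫`, for a nonzero integral ideal `𝔞`:
`T_𝔞 (L, L') = N(𝔞)⁻¹ ∑ (M, M')`, extended linearly to `ℚ𝓜₀(𝔫)`. -/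
def heckeT (n : Ideal (𝓞 K)) {a : Ideal (𝓞 K)} (ha : a ≠ ⊥) :
    ModularSpace K n →ₗ[ℚ] ModularSpace K n :=
  Finsupp.linearCombination ℚ fun P =>
    ((Ideal.absNorm a : ℚ)⁻¹) • ∑ Q ∈ (heckeSet_finite ha P).toFinset, Finsupp.single Q (1 : ℚ)

/-- The integral ideal `𝔪⁻¹𝔫`, for `𝔪 ∣ 𝔫` (unique when `𝔫 ≠ 0`). -/
def cofactor {m n : Ideal (𝓞 K)} (h : m ∣ n) : Ideal (𝓞 K) := h.choose

lemma mul_cofactor {m n : Ideal (𝓞 K)} (h : m ∣ n) : m * cofactor h = n := h.choose_spec.symm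


section LevelPoint

variable {n m d : Ideal (𝓞 K)}

lemma cofactor_ne_bot (hn : n ≠ ⊥) (hm : m ∣ n) : cofactor hm ≠ ⊥ :=
  fun h => hn (by rw [← mul_cofactor hm, h, Ideal.mul_bot])

lemma le_cofactor (hm : m ∣ n) : n ≤ cofactor hm :=
  (mul_cofactor hm).symm.le.trans Ideal.mul_le_right

lemma ModularPoint.smul_mem (P : ModularPoint K n) {r : 𝓞 K} (hr : r ∈ n) {x : RowSpace K}
    (hx : x ∈ P.L') : r • x ∈ P.L := by
  obtain ⟨β, hL', hβ⟩ := (nonempty_relQuot_equiv_iff P.le n).1 P.quot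
  rw [hL'] at hx
  obtain ⟨y, hy, z, hz, rfl⟩ := Submodule.mem_sup.1 hx
  obtain ⟨s, rfl⟩ := Submodule.mem_span_singleton.1 hz
  rw [smul_add, smul_comm]
  exact add_mem (P.L.smul_mem r hy) (P.L.smul_mem s ((hβ r).2 hr))

lemma isLattice_level (hd : d ≠ ⊥) (P : ModularPoint K n) : IsLattice (P.L ⊓ d • P.L') := by
  obtain ⟨r, hr, hr0⟩ := Submodule.exists_mem_ne_zero_of_ne_bot hd
  exact P.isLattice.of_le (L₀ := P.L) inf_le_left hr0
    (fun x hx => ⟨P.L.smul_mem r hx, Submodule.smul_mem_smul hr (P.le hx)⟩)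
    (fun x hx => ⟨1, one_ne_zero, by simpa using hx⟩)

lemma isLattice_level' (hn : n ≠ ⊥) (hm : m ∣ n) (hd : d ∣ cofactor hm) (P : ModularPoint K n) :
    IsLattice ((P.L ⊓ d • P.L') ⊔ cofactor hm • P.L') := by
  obtain ⟨r, hr, hr0⟩ := Submodule.exists_mem_ne_zero_of_ne_bot hn
  refine P.isLattice'.of_le (L₀ := P.L ⊓ d • P.L')
    (sup_le (inf_le_left.trans P.le) Submodule.smul_le_right)
    one_ne_zero (fun x hx => ?_) (fun x hx => ⟨r, hr0, ?_⟩)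
  · rw [one_smul]; exact Submodule.mem_sup_left hx
  · exact ⟨P.smul_mem hr hx,
      Submodule.smul_mem_smul (Ideal.le_of_dvd hd (le_cofactor hm hr)) hx⟩

lemma quot_level (hn : n ≠ ⊥) (hm : m ∣ n) (hd : d ∣ cofactor hm) (P : ModularPoint K n) :
    Nonempty (relQuot ((P.L ⊓ d • P.L') ⊔ cofactor hm • P.L') (P.L ⊓ d • P.L') ≃ₗ[𝓞 K]
      (𝓞 K ⧸ m)) := by
  have hmul := mul_cofactor hm
  have he0 := cofactor_ne_bot hn hm
  have hed : cofactor hm ≤ d := Ideal.le_of_dvd hd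
  have hne := le_cofactor hm
  rw [nonempty_relQuot_equiv_iff le_sup_left]
  obtain ⟨β, hL', hβ⟩ := (nonempty_relQuot_equiv_iff P.le n).1 P.quot
  have hβ' : β ∈ P.L' := by
    rw [hL']; exact Submodule.mem_sup_right (Submodule.mem_span_singleton_self _)
  obtain ⟨c, hc⟩ := IsDedekindDomain.exists_sup_span_eq hne hn
  have hce : c ∈ cofactor hm := by
    rw [← hc]; exact Submodule.mem_sup_right (Ideal.mem_span_singleton_self c)
  refine ⟨c • β, le_antisymm (sup_le le_sup_left ?_) (sup_le le_sup_left ?_), ?_⟩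
  · refine Submodule.smul_le.2 fun x hx v hv => ?_
    rw [hL'] at hv
    obtain ⟨y, hy, z, hz, rfl⟩ := Submodule.mem_sup.1 hv
    obtain ⟨s, rfl⟩ := Submodule.mem_span_singleton.1 hz
    rw [smul_add]
    refine add_mem (Submodule.mem_sup_left
      ⟨P.L.smul_mem x hy, Submodule.smul_mem_smul (hed hx) (P.le hy)⟩) ?_
    rw [← hc] at hx
    obtain ⟨u, hu, w, hw, rfl⟩ := Submodule.mem_sup.1 hx
    obtain ⟨t, rfl⟩ := Ideal.mem_span_singleton'.1 hw
    rw [smul_comm, add_smul, mul_smul]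
    exact Submodule.smul_mem _ s (Submodule.add_mem_sup
      ⟨(hβ u).2 hu, Submodule.smul_mem_smul (hed (hne hu)) hβ'⟩
      (Submodule.smul_mem _ t (Submodule.mem_span_singleton_self _)))
  · rw [Submodule.span_singleton_le_iff_mem]
    exact Submodule.mem_sup_right (Submodule.smul_mem_smul hce hβ')
  · intro r
    have h1 : r • c • β ∈ P.L ⊓ d • P.L' ↔ r * c ∈ n := by
      rw [smul_smul, ← hβ]
      exact ⟨fun h => h.1, fun h => ⟨h, Submodule.smul_mem_smul
        (Ideal.mul_mem_left _ _ (hed hce)) hβ'⟩⟩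
    rw [h1]
    constructor
    · intro h
      have h2 : Ideal.span {r} * cofactor hm ≤ m * cofactor hm :=
        calc Ideal.span {r} * cofactor hm = Ideal.span {r} * (n ⊔ Ideal.span {c}) := by rw [hc]
          _ ≤ n := by
            rw [Ideal.mul_sup, Ideal.span_singleton_mul_span_singleton]
            exact sup_le Ideal.mul_le_right ((Ideal.span_singleton_le_iff_mem _).2 h)
          _ = m * cofactor hm := hmul.symm
      have h3 := Ideal.le_of_dvd ((mul_dvd_mul_iff_right
        (show cofactor hm ≠ 0 from he0)).1 (Ideal.dvd_iff_le.2 h2))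
      exact h3 (Ideal.mem_span_singleton_self r)
    · intro h
      rw [← hmul]
      exact Ideal.mul_mem_mul h hce

/-- For `𝔪 ∣ 𝔫` and `𝔡 ∣ 𝔪⁻¹𝔫`, the modular point `(L ∩ 𝔡L', (L ∩ 𝔡L') + 𝔪⁻¹𝔫L')` of level `𝔪`
attached to the modular point `(L, L')` of level `𝔫`. -/
def levelPoint (hn : n ≠ ⊥) (hm : m ∣ n) (hd : d ∣ cofactor hm) (P : ModularPoint K n) :
    ModularPoint K m where
  L := P.L ⊓ d • P.L'
  L' := (P.L ⊓ d • P.L') ⊔ cofactor hm • P.L'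
  isLattice := isLattice_level (ne_zero_of_dvd_ne_zero (cofactor_ne_bot hn hm) hd) P
  isLattice' := isLattice_level' hn hm hd P
  le := le_sup_left
  quot := quot_level hn hm hd P

end LevelPoint

/-- The level-changing operator `A_𝔡 : ℚ𝓜₀(𝔫) → ℚ𝓜₀(𝔪)`, the linear extension of
`A_𝔡 (L, L') = N(𝔡) (L ∩ 𝔡L', (L ∩ 𝔡L') + 𝔪⁻¹𝔫L')`. -/
def levelA {n m d : Ideal (𝓞 K)} (hn : n ≠ ⊥) (hm : m ∣ n) (hd : d ∣ cofactor hm) :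
    ModularSpace K n →ₗ[ℚ] ModularSpace K m :=
  Finsupp.linearCombination ℚ fun P =>
    (Ideal.absNorm d : ℚ) • Finsupp.single (levelPoint hn hm hd P) (1 : ℚ)

end ModularPoints

end ModularLattice

end

/-! Coprimality gives α ∈ 𝔞 and ν ∈ 𝔫 with α + ν = 1, so membership of x in a submodule can be
tested on αx and νx separately. If [M : L] = 𝔞, then α sends M into L and M + L' into L', while ν
sends L' into L and, since 𝔫 ⊆ 𝔡, sends L into L ∩ 𝔡L'. Thus 𝔞 kills the Hecke step and 𝔫 kills the
level change, and the two moves are independent. Concretely, with M' = M + L' and N = M ∩ 𝔡M', one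
gets N ∩ L = L ∩ 𝔡L' and N + L = M, so N/(L ∩ 𝔡L') ≅ M/L. Hence M ↦ N is a bijection from the Hecke
terms at (L, L') to those at its level-changed point, with inverse N ↦ N + L
(`levelPoint_mem_heckeSet`, `exists_levelPoint_eq`). The factors N(𝔞)⁻¹ and N(𝔡) are scalars and
commute. -/

namespace ModularLattice

open scoped NumberField TensorProduct

/-! ### Lattices, indices and comaximal elements -/

section Auxiliary

variable {K : Type*} [Field K] [NumberField K]

/-- A finitely generated submodule containing a lattice with torsion quotient is a lattice. -/
lemma IsLattice.of_ge {L M : Submodule (𝓞 K) (RowSpace K)} (hL : IsLattice L) (hle : L ≤ M)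
    (hM : M.FG) {r : 𝓞 K} (hr : r ≠ 0) (hmul : ∀ x ∈ M, r • x ∈ L) : IsLattice M := by
  have hspan : Submodule.span K (M : Set (RowSpace K)) = Submodule.span K (L : Set (RowSpace K)) := by
    refine le_antisymm (Submodule.span_le.2 fun x hx => ?_) (Submodule.span_mono hle)
    have hr' : (r : K) ≠ 0 := by simpa using hr
    have h : ((r : K)⁻¹) • (r • x) = x := by
      rw [← algebraMap_smul K r x, smul_smul, inv_mul_cancel₀ hr', one_smul]
    rw [← h]
    exact Submodule.smul_mem _ _ (Submodule.subset_span (hmul x hx))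
  refine ⟨hM, ?_, ?_⟩
  · rw [hspan]; exact hL.finrank_span
  · rw [eq_top_iff, ← hL.span_eq_top]
    exact Submodule.span_mono hle

/-- The second isomorphism theorem for relative quotients. -/
lemma nonempty_relQuot_equiv {A B C D : Submodule (𝓞 K) (RowSpace K)} (hC : A ⊓ B = C)
    (hD : A ⊔ B = D) : Nonempty (relQuot A C ≃ₗ[𝓞 K] relQuot D B) := by
  subst hC hD
  exact ⟨LinearMap.quotientInfEquivSupQuotient A B⟩

/-- The index of a lattice annihilates the quotient. -/
lemma HasIndex.smul_mem {M L : Submodule (𝓞 K) (RowSpace K)} {a : Ideal (𝓞 K)}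
    (h : HasIndex M L a) {r : 𝓞 K} (hr : r ∈ a) {x : RowSpace K} (hx : x ∈ M) : r • x ∈ L := by
  obtain ⟨-, a₁, a₂, -, rfl, ⟨e⟩⟩ := h
  have h0 : (Submodule.Quotient.mk (r • ⟨x, hx⟩) : relQuot M L) = 0 := by
    apply e.injective
    rw [Submodule.Quotient.mk_smul, map_smul, map_zero]
    generalize e (Submodule.Quotient.mk ⟨x, hx⟩) = y
    exact Prod.ext (quot_smul_eq_zero (Ideal.mul_le_left hr) y.1)
      (quot_smul_eq_zero (Ideal.mul_le_right hr) y.2)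
  exact (Submodule.Quotient.mk_eq_zero (L.submoduleOf M)).1 h0

lemma HasIndex.congr {M L M₁ L₁ : Submodule (𝓞 K) (RowSpace K)} {a : Ideal (𝓞 K)}
    (h : HasIndex M L a) (hle : L₁ ≤ M₁)
    (e : Nonempty (relQuot M₁ L₁ ≃ₗ[𝓞 K] relQuot M L)) : HasIndex M₁ L₁ a := by
  obtain ⟨-, a₁, a₂, h₁, h₂, ⟨f⟩⟩ := h
  obtain ⟨e⟩ := e
  exact ⟨hle, a₁, a₂, h₁, h₂, ⟨e.trans f⟩⟩

/-- Membership can be checked after multiplication by two comaximal elements. -/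
lemma mem_of_smul_mem_of_add_eq_one {R V : Type*} [CommRing R] [AddCommGroup V] [Module R V]
    {S : Submodule R V} {r s : R} (h : r + s = 1) {x : V} (hr : r • x ∈ S) (hs : s • x ∈ S) :
    x ∈ S := by
  rw [← one_smul R x, ← h, add_smul]
  exact add_mem hr hs

/-- If `r` maps `X` into `Y`, it maps `d • X` into `d • Y`. -/
lemma smul_mem_ideal_smul {R V : Type*} [CommRing R] [AddCommGroup V] [Module R V]
    {X Y : Submodule R V} {d : Ideal R} {r : R} (h : ∀ x ∈ X, r • x ∈ Y) {x : V}
    (hx : x ∈ d • X) : r • x ∈ d • Y := by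
  refine Submodule.smul_induction_on hx (fun t ht y hy => ?_) (fun y z hy hz => ?_)
  · rw [smul_comm]; exact Submodule.smul_mem_smul ht (h y hy)
  · rw [smul_add]; exact add_mem hy hz

/-- Transfers what is known about M/L to (M + L')/L', the second component of a Hecke term. -/
lemma smul_sup_mem {R V : Type*} [CommRing R] [AddCommGroup V] [Module R V]
    {M L L' : Submodule R V} (hle : L ≤ L') {r : R} (h : ∀ x ∈ M, r • x ∈ L) :
    ∀ x ∈ M ⊔ L', r • x ∈ L' := by
  intro x hx
  obtain ⟨y, hy, z, hz, rfl⟩ := Submodule.mem_sup.1 hx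
  rw [smul_add]
  exact add_mem (hle (h y hy)) (L'.smul_mem r hz)

lemma isCoprime_of_isPrime_of_not_dvd {R : Type*} [CommRing R] [IsDedekindDomain R]
    {p n : Ideal R} (hp : p ≠ ⊥) (hprime : p.IsPrime) (h : ¬ p ∣ n) : IsCoprime p n := by
  rw [Ideal.isCoprime_iff_sup_eq]
  refine (hprime.isMaximal hp).out.2 _ (lt_of_le_of_ne le_sup_left fun he => h ?_)
  rw [Ideal.dvd_iff_le, he]
  exact le_sup_right

end Auxiliary

/-! ### The bijection between Hecke terms -/

section Commutation

variable {K : Type*} [Field K] [NumberField K] {n m d a : Ideal (𝓞 K)}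

/-- The index survives by the second isomorphism theorem, from the diamond with top M and bottom L ∩
𝔡L'. The extra equation recovers M from its image, which yields injectivity later. -/
lemma levelPoint_mem_heckeSet (hn : n ≠ ⊥) (hm : m ∣ n) (hd : d ∣ cofactor hm)
    (hc : IsCoprime a n) {P Q : ModularPoint K n} (hQ : Q ∈ heckeSet a P) :
    levelPoint hn hm hd Q ∈ heckeSet a (levelPoint hn hm hd P) ∧
      (levelPoint hn hm hd Q).L ⊔ P.L = Q.L := by
  obtain ⟨α, hα, ν, hν, h1⟩ := Ideal.isCoprime_iff_exists.1 hc
  obtain ⟨hI, hQL'⟩ := hQ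
  have hed : cofactor hm ≤ d := Ideal.le_of_dvd hd
  have hνd : ν ∈ d := hed (le_cofactor hm hν)
  have hαL : ∀ x ∈ Q.L, α • x ∈ P.L := fun x hx => hI.smul_mem hα hx
  have hαL' : ∀ x ∈ Q.L', α • x ∈ P.L' := hQL' ▸ smul_sup_mem P.le hαL
  have hLL' : P.L' ≤ Q.L' := hQL' ▸ le_sup_right
  have hinf : (Q.L ⊓ d • Q.L') ⊓ P.L = P.L ⊓ d • P.L' := by
    refine le_antisymm ?_ ?_
    · rintro x ⟨⟨-, hxd⟩, hxL⟩
      exact ⟨hxL, mem_of_smul_mem_of_add_eq_one h1 (smul_mem_ideal_smul hαL' hxd)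
        (Submodule.smul_mem_smul hνd (P.le hxL))⟩
    · rintro x ⟨hxL, hxd⟩
      exact ⟨⟨hI.1 hxL, Submodule.smul_mono (le_refl d) hLL' hxd⟩, hxL⟩
  have hsup : (Q.L ⊓ d • Q.L') ⊔ P.L = Q.L := by
    refine le_antisymm (sup_le inf_le_left hI.1) fun x hx => ?_
    exact mem_of_smul_mem_of_add_eq_one h1 (Submodule.mem_sup_right (hαL x hx))
      (Submodule.mem_sup_left ⟨Q.L.smul_mem ν hx, Submodule.smul_mem_smul hνd (Q.le hx)⟩)
  have hle : P.L ⊓ d • P.L' ≤ Q.L ⊓ d • Q.L' := hinf ▸ inf_le_left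
  refine ⟨⟨hI.congr hle (nonempty_relQuot_equiv hinf hsup), ?_⟩, hsup⟩
  change (Q.L ⊓ d • Q.L') ⊔ cofactor hm • Q.L' =
    (Q.L ⊓ d • Q.L') ⊔ ((P.L ⊓ d • P.L') ⊔ cofactor hm • P.L')
  rw [← sup_assoc, sup_eq_left.2 hle]
  refine le_antisymm (sup_le le_sup_left ?_)
    (sup_le_sup_left (Submodule.smul_mono le_rfl hLL') _)
  -- Since 𝔪⁻¹𝔫 ⊆ 𝔡, the M-part of 𝔪⁻¹𝔫(M + L') is already absorbed by M ∩ 𝔡M'.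
  have hM : cofactor hm • Q.L ≤ Q.L ⊓ d • Q.L' :=
    le_inf Submodule.smul_le_right (Submodule.smul_mono hed Q.le)
  calc cofactor hm • Q.L' = cofactor hm • Q.L ⊔ cofactor hm • P.L' := by
        rw [hQL', Submodule.smul_sup]
    _ ≤ _ := sup_le_sup_right hM _

/-- Surjectivity: the preimage of R = (N, N') is (N + L, N + L + L'). -/
lemma exists_levelPoint_eq (hn : n ≠ ⊥) (hm : m ∣ n) (hd : d ∣ cofactor hm) (ha : a ≠ ⊥)
    (hc : IsCoprime a n) {P : ModularPoint K n} {R : ModularPoint K m}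
    (hR : R ∈ heckeSet a (levelPoint hn hm hd P)) :
    ∃ Q ∈ heckeSet a P, levelPoint hn hm hd Q = R := by
  obtain ⟨α, hα, ν, hν, h1⟩ := Ideal.isCoprime_iff_exists.1 hc
  -- A separate nonzero element of 𝔞 is needed for the lattice conditions: α may be 0, for instance
  -- when ν = 1.
  obtain ⟨r, hra, hr0⟩ := Submodule.exists_mem_ne_zero_of_ne_bot ha
  have hI : HasIndex R.L (P.L ⊓ d • P.L') a := hR.1
  have hνd : ν ∈ d := Ideal.le_of_dvd hd (le_cofactor hm hν)
  have hνL : ∀ x ∈ P.L, ν • x ∈ P.L ⊓ d • P.L' := fun x hx =>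
    ⟨P.L.smul_mem ν hx, Submodule.smul_mem_smul hνd (P.le hx)⟩
  have haL : ∀ s ∈ a, ∀ x ∈ R.L ⊔ P.L, s • x ∈ P.L := fun s hs =>
    smul_sup_mem le_rfl fun x hx => (hI.smul_mem hs hx).1
  have haL' : ∀ s ∈ a, ∀ x ∈ (R.L ⊔ P.L) ⊔ P.L', s • x ∈ P.L' := fun s hs =>
    smul_sup_mem P.le (haL s hs)
  have hinf : R.L ⊓ P.L = P.L ⊓ d • P.L' := by
    refine le_antisymm ?_ (le_inf hI.1 inf_le_left)
    rintro x ⟨hxR, hxL⟩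
    exact mem_of_smul_mem_of_add_eq_one h1 (hI.smul_mem hα hxR) (hνL x hxL)
  obtain ⟨e⟩ := nonempty_relQuot_equiv hinf rfl
  have hQI : HasIndex (R.L ⊔ P.L) P.L a := hI.congr le_sup_right ⟨e.symm⟩
  -- This makes L'/L isomorphic to (N + L + L')/(N + L), so the candidate has level exactly 𝔫.
  have hinf' : P.L' ⊓ (R.L ⊔ P.L) = P.L := by
    refine le_antisymm ?_ (le_inf P.le le_sup_right)
    rintro x ⟨hxL', hx⟩
    exact mem_of_smul_mem_of_add_eq_one h1 (haL α hα x hx) (P.smul_mem hν hxL')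
  obtain ⟨f⟩ := nonempty_relQuot_equiv hinf' (sup_comm _ _)
  obtain ⟨g⟩ := P.quot
  have hfg := R.isLattice.fg.sup P.isLattice.fg
  let Q : ModularPoint K n :=
    { L := R.L ⊔ P.L
      L' := (R.L ⊔ P.L) ⊔ P.L'
      isLattice := P.isLattice.of_ge le_sup_right hfg hr0 (haL r hra)
      isLattice' := P.isLattice'.of_ge le_sup_right (hfg.sup P.isLattice'.fg) hr0 (haL' r hra)
      le := le_sup_left
      quot := ⟨f.symm.trans g⟩ }
  have hQ : Q ∈ heckeSet a P := ⟨hQI, rfl⟩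
  have hL : (levelPoint hn hm hd Q).L = R.L := by
    change (R.L ⊔ P.L) ⊓ d • ((R.L ⊔ P.L) ⊔ P.L') = R.L
    refine le_antisymm ?_ (le_inf le_sup_left fun x hx => ?_)
    · rintro x ⟨hx, hxd⟩
      refine mem_of_smul_mem_of_add_eq_one h1
        (hI.1 ⟨haL α hα x hx, smul_mem_ideal_smul (haL' α hα) hxd⟩) ?_
      -- ν maps N + L into N because νL ⊆ L ∩ 𝔡L' ⊆ N.
      rw [sup_comm] at hx
      exact smul_sup_mem hI.1 hνL x hx
    · exact mem_of_smul_mem_of_add_eq_one h1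
        (Submodule.smul_mono (le_refl d) le_sup_right (hI.smul_mem hα hx).2)
        (Submodule.smul_mem_smul hνd (Submodule.mem_sup_left (Submodule.mem_sup_left hx)))
  refine ⟨Q, hQ, ModularPoint.ext hL ?_⟩
  -- In a Hecke term the second component is determined by the first, so agreement of the first
  -- components suffices.
  rw [(levelPoint_mem_heckeSet hn hm hd hc hQ).1.2, hR.2, hL]

/-- Hecke operators commute with level-changing operators away from the level. -/
lemma levelA_comp_heckeT (hn : n ≠ ⊥) (hm : m ∣ n) (hd : d ∣ cofactor hm) (ha : a ≠ ⊥)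
    (hc : IsCoprime a n) :
    levelA hn hm hd ∘ₗ heckeT n ha = heckeT m ha ∘ₗ levelA (K := K) hn hm hd := by
  refine Finsupp.lhom_ext' fun P => LinearMap.ext_ring ?_
  have hsum : ∑ Q ∈ (heckeSet_finite ha P).toFinset,
        Finsupp.single (levelPoint hn hm hd Q) (1 : ℚ) =
      ∑ R ∈ (heckeSet_finite ha (levelPoint hn hm hd P)).toFinset, Finsupp.single R (1 : ℚ) := by
    refine Finset.sum_bij (fun Q _ => levelPoint hn hm hd Q) ?_ ?_ ?_ (fun _ _ => rfl)
    · intro Q hQ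
      rw [Set.Finite.mem_toFinset] at hQ ⊢
      exact (levelPoint_mem_heckeSet hn hm hd hc hQ).1
    -- Injectivity: Q.L is the sum of the first component of its image and P.L.
    · intro Q hQ Q₁ hQ₁ h
      rw [Set.Finite.mem_toFinset] at hQ hQ₁
      have hL : Q.L = Q₁.L := by
        rw [← (levelPoint_mem_heckeSet hn hm hd hc hQ).2, h,
          (levelPoint_mem_heckeSet hn hm hd hc hQ₁).2]
      exact ModularPoint.ext hL (by rw [hQ.2, hQ₁.2, hL])
    · intro R hR
      rw [Set.Finite.mem_toFinset] at hR
      obtain ⟨Q, hQ, h⟩ := exists_levelPoint_eq hn hm hd ha hc hR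
      exact ⟨Q, (Set.Finite.mem_toFinset _).2 hQ, h⟩
  simp only [LinearMap.comp_apply, Finsupp.lsingle_apply, heckeT, levelA,
    Finsupp.linearCombination_single, one_smul, map_smul, map_sum]
  rw [← Finset.smul_sum, hsum, smul_comm]

end Commutation

end ModularLattice

theorem mainTheorem6 (K : Type*) [Field K] [NumberField K]
    (n m d : Ideal (𝓞 K)) (hn : n ≠ ⊥) (hm : m ∣ n) (hd : d ∣ ModularLattice.cofactor hm) :
    (∀ (p : Ideal (𝓞 K)) (hp : p ≠ ⊥), p.IsPrime → ¬ p ∣ n →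
      ModularLattice.levelA hn hm hd ∘ₗ ModularLattice.heckeT n hp =
        ModularLattice.heckeT m hp ∘ₗ ModularLattice.levelA hn hm hd) ∧
    (∀ (a : Ideal (𝓞 K)) (ha : a ≠ ⊥), IsCoprime a n →
      ModularLattice.levelA hn hm hd ∘ₗ ModularLattice.heckeT n ha =
        ModularLattice.heckeT m ha ∘ₗ ModularLattice.levelA hn hm hd) := by
  exact ⟨fun p hp hprime h => ModularLattice.levelA_comp_heckeT hn hm hd hp
      (ModularLattice.isCoprime_of_isPrime_of_not_dvd hp hprime h),
    fun a ha hc => ModularLattice.levelA_comp_heckeT hn hm hd ha hc⟩
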